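/- All polynomials are over $\mathbb{C}$. An algebraic formula is a tree whose leaves are labelled by constants or variables and whose inner nodes are product gates or sum gates of arbitrary positive fan-in, the edges into a sum gate carrying constants (so that it computes a linear combination of its children). Its size is its number of nodes, its depth the number of edges on a longest root-to-leaf path. An algebraic branching program (ABP) is a layered directed graph with a single source in the first layer and a single sink in the last, each edge going from one layer to the next and being labelled by a polynomial of degree at most $1$; it computes the sum over all source-sink paths of the product of the labels, and its size is its number of vertices. $\mathrm{VF}$ (resp. $\mathrm{VBP}$) is the class of sequences $(f_k)_{k\ge 0}$ of polynomials in $\mathrm{poly}(k)$ many variables that have formulas (resp. ABPs) of size $\mathrm{poly}(k)$. For $\lambda=(\lambda_1\ge\dots\ge\lambda_\ell)$ and $n\ge \ell$, with $\lambda_j=0$ for $j>\ell$, the Schur polynomial is $$s_\lambda(x_1,\dots,x_n)=\frac{\det\big((x_i^{\lambda_j+n-j})_{i,j\in[n]}\big)}{\det\big((x_i^{n-j})_{i,j\in[n]}\big)}.$$ Call $(\lambda,n)$, with $\lambda=(\lambda_1,\dots,\lambda_\ell)$ and $\ell\ge 1$, admissible if $\lambda_i\ge\lambda_{i+1}+(\ell-1)$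 for all $1\le i<\ell$, $\lambda_\ell\ge \ell$, and $n\ge\lambda_1+\ell$. Theorem. (1) There are a polynomial $P$ and a constant $c$, both absolute, such that for every admissible $(\lambda,n)$ and all $s,\Delta$: if $s_\lambda(x_1,\dots,x_n)$ has an algebraic formula of size at most $s$ and depth at most $\Delta$, then the $\ell\times\ell$ symbolic determinant $\det\big((x_{ij})_{i,j\in[\ell]}\big)$ has an algebraic formula of size at most $P(s)$ and depth at most $\Delta+c$. (2) Let $(\lambda^{(k)},n_k)_{k\ge 0}$ be a sequence of admissible pairs whose lengths $\ell_k$ satisfy $k\le p(\ell_k)$ for all $k$ and some fixed polynomial $p$. If $\mathrm{VBP}\ne\mathrm{VF}$, then the Schur polynomials $s_{\lambda^{(k)}}(x_1,\dots,x_{n_k})$ do not have algebraic formulas of size polynomial in $k$. (3) There are sequences as in (2) with, in addition, $n_k$ bounded by a polynomial in $k$ (so that $k$, $\ell_k$, $n_k$ and $\sum_i\lambda^{(k)}_i$ are all polynomially related). -/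

import Mathlib

open MvPolynomial

noncomputable section

/-! ### Schur polynomials (bialternant definition) -/

/-- The sequence `λ = (λ_1, …, λ_ℓ)` continued by zeros; indices start at `0`. -/
def extendByZero {ℓ : ℕ} (lam : Fin ℓ → ℕ) (j : ℕ) : ℕ :=
  if h : j < ℓ then lam ⟨j, h⟩ else 0

/-- The determinant of `(x_i ^ (λ_j + n - j))`, `1 ≤ i, j ≤ n`
(with the zero-based column index `j` the exponent reads `λ_j + (n - 1 - j)`). -/
def alternant {ℓ : ℕ} (lam : Fin ℓ → ℕ) (n : ℕ) : MvPolynomial (Fin n) ℂ :=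
  Matrix.det (Matrix.of fun i j : Fin n =>
    (X i : MvPolynomial (Fin n) ℂ) ^ (extendByZero lam j + (n - 1 - (j : ℕ))))

/-- The determinant of `(x_i ^ (n - j))`, `1 ≤ i, j ≤ n`. -/
def vandermondeDet (n : ℕ) : MvPolynomial (Fin n) ℂ :=
  Matrix.det (Matrix.of fun i j : Fin n =>
    (X i : MvPolynomial (Fin n) ℂ) ^ (n - 1 - (j : ℕ)))

/-- The quotient that defines the Schur polynomial is a polynomial. -/
theorem vandermondeDet_dvd_alternant {ℓ : ℕ} (lam : Fin ℓ → ℕ) (n : ℕ) :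
    vandermondeDet n ∣ alternant lam n := by
  classical
  set P : Polynomial (MvPolynomial (Fin n) ℂ) :=
    ∏ i : Fin n, (Polynomial.X - Polynomial.C (X i)) with hP
  have hPm : P.Monic := Polynomial.monic_prod_of_monic _ _ fun i _ => Polynomial.monic_X_sub_C _
  have hdeg : P.natDegree = n := by
    rw [hP, Polynomial.natDegree_prod_of_monic _ _ fun i _ => Polynomial.monic_X_sub_C _]
    simp
  have key : ∀ (i : Fin n) (m : ℕ), (X i : MvPolynomial (Fin n) ℂ) ^ m =
      ∑ k : Fin n, X i ^ (n - 1 - (k : ℕ)) *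
        ((Polynomial.X ^ m) %ₘ P).coeff (n - 1 - (k : ℕ)) := by
    intro i m
    have hroot : P.eval (X i) = 0 := by
      rw [hP, Polynomial.eval_prod]
      exact Finset.prod_eq_zero (Finset.mem_univ i) (by simp)
    have h1 := congrArg (Polynomial.eval (X i : MvPolynomial (Fin n) ℂ))
      (Polynomial.modByMonic_add_div (Polynomial.X ^ m) P)
    rw [Polynomial.eval_add, Polynomial.eval_mul, hroot, zero_mul, add_zero,
      Polynomial.eval_pow, Polynomial.eval_X] at h1
    have hn : 0 < n := i.pos
    have hlt : ((Polynomial.X ^ m) %ₘ P).natDegree < n := by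
      have := Polynomial.natDegree_modByMonic_lt (Polynomial.X ^ m) hPm
        (by intro h; rw [h] at hdeg; simp at hdeg; omega)
      omega
    rw [← h1, Polynomial.eval_eq_sum_range' hlt, ← Finset.sum_range_reflect,
      Finset.sum_range]
    exact Finset.sum_congr rfl fun k _ => mul_comm _ _
  refine ⟨Matrix.det (Matrix.of fun k j : Fin n =>
    ((Polynomial.X ^ (extendByZero lam j + (n - 1 - (j : ℕ)))) %ₘ P).coeff (n - 1 - (k : ℕ))), ?_⟩
  rw [vandermondeDet, ← Matrix.det_mul, alternant]
  congr 1
  ext1 i j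
  rw [Matrix.mul_apply, Matrix.of_apply, key i]
  rfl

/-- The Schur polynomial `s_λ(x_1, …, x_n)`, for `n ≥ ℓ`: the quotient of the alternant of `λ` by
the Vandermonde determinant (unique, because the latter is a nonzero element of a domain). -/
def schurPoly {ℓ : ℕ} (lam : Fin ℓ → ℕ) (n : ℕ) : MvPolynomial (Fin n) ℂ :=
  (vandermondeDet_dvd_alternant lam n).choose

theorem vandermondeDet_mul_schurPoly {ℓ : ℕ} (lam : Fin ℓ → ℕ) (n : ℕ) :
    vandermondeDet n * schurPoly lam n = alternant lam n :=
  (vandermondeDet_dvd_alternant lam n).choose_spec.symm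

/-! ### Algebraic formulas -/

/-- Algebraic formulas over `ℂ` in variables indexed by `σ`: trees whose leaves carry constants or
variables, and whose inner nodes are product gates, or sum gates with constants on the incoming
edges. Gates have any positive number `m + 1` of children. -/
inductive AlgFormula (σ : Type) : Type
  | const (c : ℂ) : AlgFormula σ
  | var (i : σ) : AlgFormula σ
  | sum (m : ℕ) (c : Fin (m + 1) → ℂ) (f : Fin (m + 1) → AlgFormula σ) : AlgFormula σ
  | prod (m : ℕ) (f : Fin (m + 1) → AlgFormula σ) : AlgFormula σ

namespace AlgFormula

/-- The polynomial computed by a formula. -/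
def eval {σ : Type} : AlgFormula σ → MvPolynomial σ ℂ
  | const c => C c
  | var i => X i
  | sum _ c f => ∑ i, C (c i) * (f i).eval
  | prod _ f => ∏ i, (f i).eval

/-- The number of nodes, leaves included. -/
def size {σ : Type} : AlgFormula σ → ℕ
  | const _ => 1
  | var _ => 1
  | sum _ _ f => 1 + ∑ i, (f i).size
  | prod _ f => 1 + ∑ i, (f i).size

/-- The number of edges of a longest path from a leaf to the root. -/
def depth {σ : Type} : AlgFormula σ → ℕ
  | const _ => 0
  | var _ => 0
  | sum _ _ f => 1 + Finset.univ.sup fun i => (f i).depth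
  | prod _ f => 1 + Finset.univ.sup fun i => (f i).depth

end AlgFormula

/-- `p` has a formula of size at most `s` and depth at most `Δ`. -/
def HasFormula {σ : Type} (p : MvPolynomial σ ℂ) (s Δ : ℕ) : Prop :=
  ∃ F : AlgFormula σ, F.eval = p ∧ F.size ≤ s ∧ F.depth ≤ Δ

/-- `p` has a formula of size at most `s` (and any depth). -/
def HasFormulaOfSize {σ : Type} (p : MvPolynomial σ ℂ) (s : ℕ) : Prop :=
  ∃ F : AlgFormula σ, F.eval = p ∧ F.size ≤ s

/-! ### Algebraic branching programs -/

/-- Algebraic branching programs over `ℂ`: layers `0, …, len` with `width i` vertices in layer `i`,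
a single source in the first and a single sink in the last layer, and an edge label of degree at
most one for every pair of vertices in consecutive layers (the label is `0` if there is no edge). -/
structure ABP (σ : Type) where
  len : ℕ
  width : Fin (len + 1) → ℕ
  width_source : width 0 = 1
  width_sink : width (Fin.last len) = 1
  label : ∀ i : Fin len, Fin (width i.castSucc) → Fin (width i.succ) → MvPolynomial σ ℂ
  label_linear : ∀ i u v, (label i u v).totalDegree ≤ 1

namespace ABP

/-- The polynomial computed by an ABP: the sum over all source-sink paths (one vertex from each
layer) of the product of the labels along the path. -/
def eval {σ : Type} (B : ABP σ) : MvPolynomial σ ℂ :=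
  ∑ path : (∀ i : Fin (B.len + 1), Fin (B.width i)),
    ∏ i : Fin B.len, B.label i (path i.castSucc) (path i.succ)

/-- The number of vertices. -/
def size {σ : Type} (B : ABP σ) : ℕ := ∑ i, B.width i

end ABP

/-! ### Polynomial families and the classes `VF` and `VBP` -/

/-- `f k ≤ poly(k)`. -/
def PolyBounded (f : ℕ → ℕ) : Prop :=
  ∃ p : Polynomial ℕ, ∀ k, f k ≤ p.eval k

/-- A sequence of polynomials over `ℂ`, the `k`-th one in the variables `x_1, …, x_{vars k}`. -/
structure PolyFamily where
  vars : ℕ → ℕ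
  poly : ∀ k, MvPolynomial (Fin (vars k)) ℂ

/-- The family has formulas of polynomial size. -/
def PolyFamily.HasPolySizeFormulas (f : PolyFamily) : Prop :=
  ∃ s : ℕ → ℕ, PolyBounded s ∧ ∀ k, HasFormulaOfSize (f.poly k) (s k)

/-- The family has algebraic branching programs of polynomial size. -/
def PolyFamily.HasPolySizeABPs (f : PolyFamily) : Prop :=
  ∃ s : ℕ → ℕ, PolyBounded s ∧ ∀ k, ∃ B : ABP (Fin (f.vars k)), B.eval = f.poly k ∧ B.size ≤ s k

/-- Families in polynomially many variables with formulas of polynomial size. (The degrees are then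
polynomially bounded as well, since a formula of size `s` has degree at most `s`.) -/
def VF : Set PolyFamily := {f | PolyBounded f.vars ∧ f.HasPolySizeFormulas}

/-- Families in polynomially many variables with ABPs of polynomial size. (The degrees are then
polynomially bounded as well, since an ABP of size `s` has degree less than `s`.) -/
def VBP : Set PolyFamily := {f | PolyBounded f.vars ∧ f.HasPolySizeABPs}

/-! ### The partitions under consideration -/

/-- `λ = (λ_1, …, λ_ℓ)` with `ℓ ≥ 1`, `λ_i ≥ λ_{i+1} + (ℓ - 1)` for `1 ≤ i < ℓ`, `λ_ℓ ≥ ℓ`, and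
`n ≥ λ_1 + ℓ`. -/
structure WellSpaced {ℓ : ℕ} (lam : Fin ℓ → ℕ) (n : ℕ) : Prop where
  length_pos : 0 < ℓ
  gap : ∀ i j : Fin ℓ, (i : ℕ) + 1 = j → lam j + (ℓ - 1) ≤ lam i
  last_ge : ∀ i : Fin ℓ, (i : ℕ) + 1 = ℓ → ℓ ≤ lam i
  first_le : ∀ i : Fin ℓ, (i : ℕ) = 0 → lam i + ℓ ≤ n

/-- The family of the Schur polynomials `s_{λ^(k)}(x_1, …, x_{n_k})`, `k = 0, 1, 2, …`. -/
def schurFamily {ℓ : ℕ → ℕ} (lam : ∀ k, Fin (ℓ k) → ℕ) (n : ℕ → ℕ) : PolyFamily where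
  vars := n
  poly k := schurPoly (lam k) (n k)

end

/-!
Write `x_i = ζ ^ i + t b_i` with `ζ` a primitive `n`-th root of unity. At `t = 0` every complete
homogeneous polynomial `h_m(x)`, `1 ≤ m < n`, vanishes, and its linear term in `t` is the power sum
`∑ i, ζ ^ (i (m - 1)) b_i`. Hence the coefficient of `t ^ ℓ` in the `ℓ × ℓ` Jacobi–Trudi determinant
of `s_λ(x)` is the determinant of these power sums. The spacing of `λ` makes the indices `m` of the
entries distinct and smaller than `n`, so that the power sums are linearly independent forms in `b`,
and a linear choice of `b` turns them into the `ℓ ^ 2` variables of the symbolic determinant. The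
coefficient is extracted from a formula of `s_λ` by interpolation in `t`.

By Cramer's rule, an ABP computes the determinant of a matrix with affine linear entries, so
formulas of polynomial size for the symbolic determinant give `VBP ⊆ VF`. The inclusion `VF ⊆ VBP`
is unconditional: a formula is evaluated sequentially, multiplying a running term by its leaves.
-/

/-! ### Formulas -/

theorem eq_C_add_sum_of_totalDegree_le_one {σ R : Type*} [CommSemiring R] [Fintype σ]
    {p : MvPolynomial σ R} (hp : p.totalDegree ≤ 1) :
    p = C (coeff 0 p) + ∑ i, C (coeff (Finsupp.single i 1) p) * X i := by
  classical
  ext d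
  simp only [coeff_add, coeff_C, coeff_sum, coeff_C_mul, coeff_X]
  rcases lt_trichotomy d.degree 1 with h | h | h
  · obtain rfl : d = 0 := (Finsupp.degree_eq_zero_iff d).1 (Nat.lt_one_iff.1 h)
    simp
  · obtain ⟨i, rfl⟩ := (Finsupp.sum_eq_one_iff d).1 h
    simp [Finsupp.single_left_inj, eq_comm (a := (0 : σ →₀ ℕ))]
  · have hcoeff : coeff d p = 0 := coeff_eq_zero_of_totalDegree_lt (hp.trans_lt h)
    have hsingle (i : σ) : Finsupp.single i 1 ≠ d := by rintro rfl; simp at h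
    have hzero : 0 ≠ d := by rintro rfl; simp at h
    simp [hcoeff, hsingle, hzero]

namespace AlgFormula

variable {σ τ : Type}

/-- Substitution of formulas for the variables of a formula. -/
def subst (φ : σ → AlgFormula τ) : AlgFormula σ → AlgFormula τ
  | const c => const c
  | var i => φ i
  | sum m c f => sum m c fun i => (f i).subst φ
  | prod m f => prod m fun i => (f i).subst φ

theorem eval_subst (φ : σ → AlgFormula τ) (F : AlgFormula σ) :
    (F.subst φ).eval = aeval (fun i => (φ i).eval) F.eval := by
  induction F with
  | const c => simp [subst, eval]
  | var i => simp [subst, eval]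
  | sum m c f ih => simp [subst, eval, ih]
  | prod m f ih => simp [subst, eval, ih]

theorem size_subst_le (φ : σ → AlgFormula τ) {b : ℕ} (hb : 1 ≤ b) (hφ : ∀ i, (φ i).size ≤ b)
    (F : AlgFormula σ) : (F.subst φ).size ≤ F.size * b := by
  induction F with
  | const c => simpa [subst, size] using hb
  | var i => simpa [subst, size] using hφ i
  | sum m c f ih | prod m f ih =>
    simp only [subst, size, add_mul, one_mul, Finset.sum_mul]
    exact add_le_add hb (Finset.sum_le_sum fun i _ => ih i)

theorem depth_subst_le (φ : σ → AlgFormula τ) {d : ℕ} (hφ : ∀ i, (φ i).depth ≤ d)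
    (F : AlgFormula σ) : (F.subst φ).depth ≤ F.depth + d := by
  induction F with
  | const c => simp [subst, depth]
  | var i => simpa [subst, depth] using hφ i
  | sum m c f ih | prod m f ih =>
    simp only [subst, depth, add_assoc]
    refine Nat.add_le_add_left (Finset.sup_le fun i hi => (ih i).trans ?_) 1
    exact Nat.add_le_add_right (Finset.le_sup (f := fun i => (f i).depth) hi) d

theorem totalDegree_eval_le_size (F : AlgFormula σ) : F.eval.totalDegree ≤ F.size := by
  induction F with
  | const c => simp [eval, size]
  | var i => simp [eval, size]
  | sum m c f ih =>
    refine totalDegree_finsetSum_le fun i hi => ?_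
    calc (C (c i) * (f i).eval).totalDegree
        ≤ (f i).eval.totalDegree := (totalDegree_mul _ _).trans (by simp)
      _ ≤ ∑ i, (f i).size :=
        (ih i).trans (Finset.single_le_sum (f := fun i => (f i).size) (fun _ _ => Nat.zero_le _) hi)
      _ ≤ 1 + ∑ i, (f i).size := Nat.le_add_left _ _
  | prod m f ih =>
    calc (∏ i, (f i).eval).totalDegree
        ≤ ∑ i, (f i).eval.totalDegree := totalDegree_finsetProd _ _
      _ ≤ ∑ i, (f i).size := Finset.sum_le_sum fun i _ => ih i
      _ ≤ 1 + ∑ i, (f i).size := Nat.le_add_left _ _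

end AlgFormula

section HasFormula

variable {σ τ : Type}

theorem HasFormula.mono {p : MvPolynomial σ ℂ} {s s' d d' : ℕ} (h : HasFormula p s d)
    (hs : s ≤ s') (hd : d ≤ d') : HasFormula p s' d' :=
  let ⟨F, hF, hsize, hdepth⟩ := h
  ⟨F, hF, hsize.trans hs, hdepth.trans hd⟩

theorem HasFormula.totalDegree_le {p : MvPolynomial σ ℂ} {s d : ℕ} (h : HasFormula p s d) :
    p.totalDegree ≤ s :=
  let ⟨F, hF, hsize, _⟩ := h
  hF ▸ F.totalDegree_eval_le_size.trans hsize

theorem hasFormula_C (c : ℂ) : HasFormula (C c : MvPolynomial σ ℂ) 1 0 :=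
  ⟨.const c, rfl, le_rfl, le_rfl⟩

theorem hasFormula_X (i : σ) : HasFormula (X i : MvPolynomial σ ℂ) 1 0 :=
  ⟨.var i, rfl, le_rfl, le_rfl⟩

theorem HasFormula.aeval {p : MvPolynomial σ ℂ} {s d b e : ℕ} (h : HasFormula p s d)
    {g : σ → MvPolynomial τ ℂ} (hb : 1 ≤ b) (hg : ∀ i, HasFormula (g i) b e) :
    HasFormula (MvPolynomial.aeval g p) (s * b) (d + e) := by
  obtain ⟨F, rfl, hsize, hdepth⟩ := h
  choose φ hφ hs hd using hg
  refine ⟨F.subst φ, ?_, (F.size_subst_le φ hb hs).trans (Nat.mul_le_mul_right _ hsize),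
    (F.depth_subst_le φ hd).trans (Nat.add_le_add_right hdepth e)⟩
  simp only [AlgFormula.eval_subst, hφ]

theorem HasFormula.sum {ι : Type*} [Fintype ι] [Nonempty ι] {p : ι → MvPolynomial σ ℂ}
    {s : ι → ℕ} {d : ℕ} (c : ι → ℂ) (h : ∀ i, HasFormula (p i) (s i) d) :
    HasFormula (∑ i, C (c i) * p i) (1 + ∑ i, s i) (d + 1) := by
  choose F hF hs hd using h
  obtain ⟨m, hm⟩ := Nat.exists_eq_succ_of_ne_zero (Fintype.card_ne_zero (α := ι))
  let e : Fin (m + 1) ≃ ι := (Fintype.equivFinOfCardEq hm).symm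
  refine ⟨.sum m (c ∘ e) (F ∘ e), ?_, ?_, ?_⟩
  · simp only [AlgFormula.eval, Function.comp, hF]
    exact e.sum_comp fun i => C (c i) * p i
  · rw [AlgFormula.size, ← e.sum_comp s]
    exact Nat.add_le_add_left (Finset.sum_le_sum fun i _ => hs (e i)) 1
  · rw [AlgFormula.depth, add_comm]
    exact Nat.add_le_add_right (Finset.sup_le fun i _ => hd (e i)) 1

theorem hasFormula_of_totalDegree_le_one [Fintype σ] {p : MvPolynomial σ ℂ}
    (hp : p.totalDegree ≤ 1) : HasFormula p (Fintype.card σ + 2) 1 := by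
  have hterms : ∀ o : Option σ, HasFormula (o.elim (C 1) X : MvPolynomial σ ℂ) 1 0 := by
    rintro (_ | i)
    exacts [hasFormula_C 1, hasFormula_X i]
  have h := HasFormula.sum (fun o : Option σ =>
    o.elim (coeff 0 p) fun i => coeff (Finsupp.single i 1) p) hterms
  rw [Fintype.sum_option] at h
  simp only [Option.elim, C_1, mul_one] at h
  rw [← eq_C_add_sum_of_totalDegree_le_one hp] at h
  exact h.mono (by simp; omega) le_rfl

end HasFormula

/-! ### Schur polynomials near the roots of unity -/

section Vandermonde

variable {A : Type*} [CommRing A] {n : ℕ}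

theorem det_pow_rev_ne_zero [IsDomain A] {x : Fin n → A} (hx : Function.Injective x) :
    (Matrix.of fun i k : Fin n => x i ^ (n - 1 - (k : ℕ))).det ≠ 0 := by
  have hrev : (Matrix.of fun i k : Fin n => x i ^ (n - 1 - (k : ℕ))) =
      (Matrix.vandermonde x).submatrix id Fin.revPerm := by
    ext i k
    simp [Matrix.vandermonde_apply, Fin.val_rev, Nat.sub_sub, add_comm]
  rw [hrev, Matrix.det_permute']
  exact mul_ne_zero ((Units.isUnit _).map (Int.castRingHom A)).ne_zero
    (Matrix.det_vandermonde_ne_zero_iff.2 hx)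

theorem eq_of_sum_pow_rev_mul_eq [IsDomain A] {x : Fin n → A} (hx : Function.Injective x)
    {u w : Fin n → A}
    (h : ∀ i, ∑ k : Fin n, x i ^ (n - 1 - (k : ℕ)) * u k =
      ∑ k : Fin n, x i ^ (n - 1 - (k : ℕ)) * w k) : u = w := by
  refine sub_eq_zero.1 (Matrix.eq_zero_of_mulVec_eq_zero (det_pow_rev_ne_zero hx) ?_)
  rw [Matrix.mulVec_sub, sub_eq_zero]
  exact funext h

theorem exists_pow_eq_sum_pow_rev_mul (x : Fin n → A) (m : ℕ) :
    ∃ c : Fin n → A, ∀ i, x i ^ m = ∑ k : Fin n, x i ^ (n - 1 - (k : ℕ)) * c k := by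
  nontriviality A
  let P : Polynomial A := ∏ i, (Polynomial.X - Polynomial.C (x i))
  have hmonic : P.Monic := Polynomial.monic_prod_X_sub_C x Finset.univ
  have hdegree : P.natDegree = n := by simp [P]
  refine ⟨fun k => (Polynomial.X ^ m %ₘ P).coeff (n - 1 - (k : ℕ)), fun i => ?_⟩
  have hroot : P.eval (x i) = 0 := by
    rw [Polynomial.eval_prod]
    exact Finset.prod_eq_zero (Finset.mem_univ i) (by simp)
  have hlt : (Polynomial.X ^ m %ₘ P).natDegree < n := by
    rw [← hdegree]
    refine Polynomial.natDegree_modByMonic_lt _ hmonic fun hone => ?_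
    simp [hone, i.pos.ne] at hdegree
  have heval : (Polynomial.X ^ m %ₘ P).eval (x i) = x i ^ m := by
    rw [Polynomial.eval, Polynomial.eval₂_modByMonic_eq_self_of_root hroot]
    simp
  rw [← heval, Polynomial.eval_eq_sum_range' hlt, ← Finset.sum_range_reflect, Finset.sum_range]
  exact Finset.sum_congr rfl fun k _ => mul_comm _ _

theorem exists_dual_of_pow {K : Type*} [Field K] {x : Fin n → K} (hx : Function.Injective x) :
    ∃ c : Matrix (Fin n) (Fin n) K, ∀ l d : Fin n,
      ∑ j, c l j * x j ^ (d : ℕ) = if l = d then 1 else 0 := by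
  have hunit : IsUnit (Matrix.vandermonde x).det :=
    isUnit_iff_ne_zero.2 (Matrix.det_vandermonde_ne_zero_iff.2 hx)
  refine ⟨(Matrix.vandermonde x)⁻¹, fun l d => ?_⟩
  simpa [Matrix.mul_apply, Matrix.one_apply, Matrix.vandermonde_apply] using
    congrFun₂ (Matrix.nonsing_inv_mul _ hunit) l d

theorem exists_coeff_eq_sum_smul_eval {K : Type*} [Field K] [Algebra K A] {x : Fin n → K}
    (hx : Function.Injective x) (l : Fin n) :
    ∃ c : Fin n → K, ∀ q : Polynomial A, q.natDegree < n →
      q.coeff l = ∑ j, c j • q.eval (algebraMap K A (x j)) := by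
  obtain ⟨c, hc⟩ := exists_dual_of_pow hx
  refine ⟨c l, fun q hq => ?_⟩
  calc q.coeff l = ∑ d : Fin n, (∑ j, c l j * x j ^ (d : ℕ)) • q.coeff d := by simp [hc]
    _ = ∑ j, c l j • ∑ d : Fin n, x j ^ (d : ℕ) • q.coeff d := by
      simp only [Finset.sum_smul, Finset.smul_sum, mul_smul]
      exact Finset.sum_comm
    _ = ∑ j, c l j • q.eval (algebraMap K A (x j)) := by
      simp only [Polynomial.eval_eq_sum_range' hq, Finset.sum_range, Algebra.smul_def, map_pow,
        mul_comm]

end Vandermonde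

section BlockDeterminant

variable {A : Type*} [CommRing A] {ℓ n : ℕ}

theorem det_eq_det_submatrix_castLE (hn : ℓ ≤ n) {M : Matrix (Fin n) (Fin n) A}
    (hM : ∀ k j : Fin n, ℓ ≤ j → M k j = (1 : Matrix (Fin n) (Fin n) A) k j) :
    M.det = (M.submatrix (Fin.castLE hn) (Fin.castLE hn)).det := by
  obtain ⟨m, rfl⟩ := Nat.exists_eq_add_of_le hn
  have hblocks : M.submatrix finSumFinEquiv finSumFinEquiv =
      Matrix.fromBlocks (M.submatrix (Fin.castAdd m) (Fin.castAdd m)) 0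
        (M.submatrix (Fin.natAdd ℓ) (Fin.castAdd m)) 1 := by
    ext (k | k) (j | j)
    · rfl
    · simp [hM, Fin.ext_iff, (k.2.trans_le (Nat.le_add_right ℓ j)).ne]
    · rfl
    · simp [hM, Matrix.one_apply]
  rw [← Matrix.det_submatrix_equiv_self finSumFinEquiv M, hblocks,
    Matrix.det_fromBlocks_zero₁₂, Matrix.det_one, mul_one]
  rfl

theorem aeval_schurPoly_eq_det [IsDomain A] [Algebra ℂ A] {lam : Fin ℓ → ℕ} (hn : ℓ ≤ n)
    {x : Fin n → A} (hx : Function.Injective x) {c : Fin n → Fin ℓ → A}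
    (hc : ∀ i j, x i ^ (lam j + (n - 1 - (j : ℕ))) = ∑ k : Fin n, x i ^ (n - 1 - (k : ℕ)) * c k j) :
    aeval x (schurPoly lam n) = (Matrix.of fun k j : Fin ℓ => c (Fin.castLE hn k) j).det := by
  let V : Matrix (Fin n) (Fin n) A := Matrix.of fun i k => x i ^ (n - 1 - (k : ℕ))
  let M : Matrix (Fin n) (Fin n) A :=
    Matrix.of fun k j => if h : (j : ℕ) < ℓ then c k ⟨j, h⟩ else (1 : Matrix _ _ A) k j
  have hVandermonde : aeval x (vandermondeDet n) = V.det := by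
    rw [vandermondeDet, AlgHom.map_det]
    congr 1
    ext i j
    simp [V]
  have hAlternant : aeval x (alternant lam n) = (V * M).det := by
    rw [alternant, AlgHom.map_det]
    congr 1
    ext i j
    by_cases hj : (j : ℕ) < ℓ
    · simpa [V, M, hj, extendByZero, Matrix.mul_apply] using hc i ⟨j, hj⟩
    · simp [V, M, hj, extendByZero, Matrix.mul_apply, Matrix.one_apply]
  have hquotient : V.det * aeval x (schurPoly lam n) = V.det * M.det := by
    rw [← hVandermonde, ← map_mul, vandermondeDet_mul_schurPoly, hAlternant, Matrix.det_mul,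
      hVandermonde]
  rw [mul_left_cancel₀ (det_pow_rev_ne_zero hx) hquotient,
    det_eq_det_submatrix_castLE hn fun k j hj => by simp [M, hj.not_gt]]
  congr 1
  ext k j
  simp [M]

end BlockDeterminant

section LowestOrder

variable {A : Type*} [CommRing A]

theorem coeff_one_pow (p : Polynomial A) (m : ℕ) :
    (p ^ m).coeff 1 = m * p.coeff 0 ^ (m - 1) * p.coeff 1 := by
  have hzero : (p ^ (m - 1)).coeff 0 = p.coeff 0 ^ (m - 1) := map_pow Polynomial.constantCoeff p _
  have h := Polynomial.coeff_derivative (p ^ m) 0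
  rw [Polynomial.derivative_pow] at h
  simpa only [Polynomial.mul_coeff_zero, Polynomial.natCast_coeff_zero, hzero,
    Polynomial.coeff_derivative, map_natCast, zero_add, Nat.cast_zero, mul_one] using h.symm

theorem coeff_card_det {ι : Type*} [Fintype ι] [DecidableEq ι] {M : Matrix ι ι (Polynomial A)}
    (hM : ∀ i j, (M i j).coeff 0 = 0) :
    M.det.coeff (Fintype.card ι) = (Matrix.of fun i j => (M i j).coeff 1).det := by
  let N : Matrix ι ι (Polynomial A) := Matrix.of fun i j => (M i j).divX
  have hfactor : M = (Polynomial.X : Polynomial A) • N := by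
    ext1 i j
    simpa [N, hM] using (Polynomial.X_mul_divX_add (M i j)).symm
  have hcoeff : M.det.coeff (Fintype.card ι) = N.det.coeff 0 := by
    rw [hfactor, Matrix.det_smul, ← zero_add (Fintype.card ι), Polynomial.coeff_X_pow_mul']
    simp
  rw [hcoeff, ← Polynomial.constantCoeff_apply, RingHom.map_det]
  congr 1

end LowestOrder

section RootsOfUnity

variable {A : Type*} [CommRing A] {n : ℕ}

theorem sum_pow_mul_pow_rev_eq_zero [IsDomain A] {x y : A} (hx : x ^ n = 1) (hy : y ^ n = 1)
    (hxy : x ≠ y) : ∑ k : Fin n, x ^ (k : ℕ) * y ^ (n - 1 - (k : ℕ)) = 0 := by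
  refine eq_zero_of_ne_zero_of_mul_right_eq_zero (sub_ne_zero.2 hxy) ?_
  rw [← Finset.sum_range fun k => x ^ k * y ^ (n - 1 - k), geom_sum₂_mul, hx, hy, sub_self]

theorem sum_rev_mul_ite {r : ℕ} (hr : r < n) (f : ℕ → A) :
    ∑ k : Fin n, f (n - 1 - (k : ℕ)) * (if (k : ℕ) + r + 1 = n then 1 else 0) = f r := by
  rw [Finset.sum_eq_single (⟨r, hr⟩ : Fin n).rev]
  · rw [Fin.val_rev, if_pos (by simp only; omega), mul_one]
    congr 1
    simp only
    omega
  · intro k _ hk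
    rw [if_neg fun h => hk (Fin.ext (by rw [Fin.val_rev]; simp only; omega)), mul_zero]
  · simp

variable [IsDomain A] {r : ℕ} {x : Fin n → Polynomial A} {u : Fin n → Polynomial A}

theorem coeff_zero_of_pow_eq_sum (hx : Function.Injective fun i => (x i).coeff 0)
    (hroot : ∀ i, (x i).coeff 0 ^ n = 1) (hr : r < n)
    (h : ∀ i, x i ^ (n + r) = ∑ k : Fin n, x i ^ (n - 1 - (k : ℕ)) * u k) (k : Fin n) :
    (u k).coeff 0 = if (k : ℕ) + r + 1 = n then 1 else 0 := by
  refine congrFun (eq_of_sum_pow_rev_mul_eq (u := fun k => (u k).coeff 0)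
    (w := fun k => if (k : ℕ) + r + 1 = n then 1 else 0) hx fun i => ?_) k
  have h0 := congrArg (Polynomial.constantCoeff) (h i)
  simp only [map_pow, map_sum, map_mul, Polynomial.constantCoeff_apply] at h0
  rw [← h0, sum_rev_mul_ite hr fun e => (x i).coeff 0 ^ e, pow_add, hroot, one_mul]

theorem coeff_one_of_pow_eq_sum (hx : Function.Injective fun i => (x i).coeff 0)
    (hroot : ∀ i, (x i).coeff 0 ^ n = 1) (hr : r < n)
    (h : ∀ i, x i ^ (n + r) = ∑ k : Fin n, x i ^ (n - 1 - (k : ℕ)) * u k) (k : Fin n) :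
    (u k).coeff 1 = ∑ i, (x i).coeff 0 ^ ((k : ℕ) + r) * (x i).coeff 1 := by
  set z : Fin n → A := fun i => (x i).coeff 0
  set b : Fin n → A := fun i => (x i).coeff 1
  refine congrFun (eq_of_sum_pow_rev_mul_eq (u := fun k => (u k).coeff 1)
    (w := fun k => ∑ i, z i ^ ((k : ℕ) + r) * b i) hx fun i => ?_) k
  have hlinear : (n + r : ℕ) * z i ^ (n + r - 1) * b i =
      ∑ k : Fin n, z i ^ (n - 1 - (k : ℕ)) * (u k).coeff 1 + r * z i ^ (r - 1) * b i := by
    have hzero (e : ℕ) : (x i ^ e).coeff 0 = z i ^ e := map_pow Polynomial.constantCoeff (x i) e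
    have h1 := congrArg (fun q => Polynomial.coeff q 1) (h i)
    simp only [Polynomial.finsetSum_coeff, Polynomial.mul_coeff_one, coeff_one_pow, hzero,
      coeff_zero_of_pow_eq_sum hx hroot hr h,
      Finset.sum_add_distrib] at h1
    rw [h1, sum_rev_mul_ite hr fun e => (e : A) * (x i).coeff 0 ^ (e - 1) * (x i).coeff 1]
  have hshift : (r : A) * z i ^ (n + r - 1) = r * z i ^ (r - 1) := by
    rcases r.eq_zero_or_pos with rfl | hpos
    · simp
    · rw [Nat.add_sub_assoc hpos, pow_add, hroot, one_mul]
  have hpowerSum : ∑ k : Fin n, z i ^ (n - 1 - (k : ℕ)) * ∑ j, z j ^ ((k : ℕ) + r) * b j =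
      n * z i ^ (n + r - 1) * b i := by
    calc _ = ∑ j, z j ^ r * b j * ∑ k : Fin n, z j ^ (k : ℕ) * z i ^ (n - 1 - (k : ℕ)) := by
          simp only [Finset.mul_sum]
          rw [Finset.sum_comm]
          exact Finset.sum_congr rfl fun j _ => Finset.sum_congr rfl fun k _ => by ring
      _ = z i ^ r * b i * (n * z i ^ (n - 1)) := by
          rw [Finset.sum_eq_single i (fun j _ hj => by
              rw [sum_pow_mul_pow_rev_eq_zero (hroot j) (hroot i) (hx.ne hj), mul_zero]) (by simp),
            ← Finset.sum_range fun k => z i ^ k * z i ^ (n - 1 - k), geom_sum₂_self]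
      _ = n * z i ^ (n + r - 1) * b i := by
          rw [show n + r - 1 = r + (n - 1) by omega, pow_add]
          ring
  rw [hpowerSum]
  push_cast at hlinear
  linear_combination -hlinear + b i * hshift

end RootsOfUnity

section JacobiTrudi

variable {ℓ n : ℕ} {lam : Fin ℓ → ℕ}

/-- The degree, minus one, of the `(k, j)` entry `h_{λ_j - j + k}` of the Jacobi–Trudi matrix. The
truncated subtraction is exact if `λ_j ≥ ℓ`. -/
def jacobiTrudiExponent (lam : Fin ℓ → ℕ) (p : Fin ℓ × Fin ℓ) : ℕ :=
  p.1 + (lam p.2 - 1 - p.2)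

namespace WellSpaced

theorem add_le_of_lt (h : WellSpaced lam n) {i j : Fin ℓ} (hij : i < j) :
    lam j + (ℓ - 1) ≤ lam i := by
  obtain ⟨j, hj⟩ := j
  induction j with
  | zero => exact absurd hij (Nat.not_lt_zero _)
  | succ j ih =>
    have hstep := h.gap ⟨j, by omega⟩ ⟨j + 1, hj⟩ rfl
    rcases (Nat.lt_succ_iff_lt_or_eq.1 hij : (i : ℕ) < j ∨ (i : ℕ) = j) with hlt | heq
    · exact hstep.trans ((Nat.le_add_right _ _).trans (ih (by omega) hlt))
    · rwa [show i = ⟨j, by omega⟩ from Fin.ext heq]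

theorem antitone (h : WellSpaced lam n) : Antitone lam :=
  antitone_iff_forall_lt.2 fun _ _ hij => (Nat.le_add_right _ _).trans (h.add_le_of_lt hij)

theorem length_le (h : WellSpaced lam n) (i : Fin ℓ) : ℓ ≤ lam i :=
  have hlt : ℓ - 1 < ℓ := Nat.sub_one_lt h.length_pos.ne'
  (h.last_ge ⟨ℓ - 1, hlt⟩ (Nat.sub_add_cancel h.length_pos)).trans
    (h.antitone (Nat.le_sub_one_of_lt i.2))

theorem add_length_le (h : WellSpaced lam n) (i : Fin ℓ) : lam i + ℓ ≤ n :=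
  (Nat.add_le_add_right (h.antitone (Nat.zero_le (i : ℕ) : ⟨0, h.length_pos⟩ ≤ i)) ℓ).trans
    (h.first_le ⟨0, h.length_pos⟩ rfl)

theorem length_le_vars (h : WellSpaced lam n) : ℓ ≤ n :=
  (Nat.le_add_left _ _).trans (h.first_le ⟨0, h.length_pos⟩ rfl)

theorem jacobiTrudiExponent_lt (h : WellSpaced lam n) (p : Fin ℓ × Fin ℓ) :
    jacobiTrudiExponent lam p + 1 < n := by
  have := h.add_length_le p.2
  have := h.length_le p.2
  have := p.1.2
  unfold jacobiTrudiExponent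
  omega

theorem jacobiTrudiExponent_injective (h : WellSpaced lam n) :
    Function.Injective (jacobiTrudiExponent lam) := by
  rintro ⟨k, j⟩ ⟨k', j'⟩ heq
  simp only [jacobiTrudiExponent] at heq
  have := h.length_le j
  have := h.length_le j'
  rcases lt_trichotomy j j' with hj | rfl | hj
  · have := h.add_le_of_lt hj
    omega
  · rw [Prod.mk.injEq]
    exact ⟨Fin.ext (by omega), rfl⟩
  · have := h.add_le_of_lt hj
    omega

theorem coeff_aeval_schurPoly {A : Type*} [CommRing A] [IsDomain A] [Algebra ℂ A]
    (h : WellSpaced lam n) {x : Fin n → Polynomial A}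
    (hx : Function.Injective fun i => (x i).coeff 0) (hroot : ∀ i, (x i).coeff 0 ^ n = 1) :
    (aeval x (schurPoly lam n)).coeff ℓ = (Matrix.of fun k j =>
      ∑ i, (x i).coeff 0 ^ jacobiTrudiExponent lam (k, j) * (x i).coeff 1).det := by
  choose c hc using fun j : Fin ℓ => exists_pow_eq_sum_pow_rev_mul x (n + (lam j - 1 - j))
  have hexponent (j : Fin ℓ) : lam j + (n - 1 - (j : ℕ)) = n + (lam j - 1 - j) := by
    have := h.length_le j
    have := h.length_le_vars
    omega
  have hr (j : Fin ℓ) : lam j - 1 - j < n := by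
    have := h.add_length_le j
    omega
  have hcoeff_zero (k j : Fin ℓ) : (c j (Fin.castLE h.length_le_vars k)).coeff 0 = 0 := by
    rw [coeff_zero_of_pow_eq_sum hx hroot (hr j) (hc j)]
    exact if_neg (h.jacobiTrudiExponent_lt (k, j)).ne
  have hcoeff_one (k j : Fin ℓ) : (c j (Fin.castLE h.length_le_vars k)).coeff 1 =
      ∑ i, (x i).coeff 0 ^ jacobiTrudiExponent lam (k, j) * (x i).coeff 1 :=
    coeff_one_of_pow_eq_sum hx hroot (hr j) (hc j) _
  have hinj : Function.Injective x := fun i j hij => hx (congrArg (fun p => p.coeff 0) hij)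
  rw [aeval_schurPoly_eq_det h.length_le_vars hinj (c := fun k j => c j k)
    fun i j => by rw [hexponent, hc]]
  simpa [hcoeff_one] using coeff_card_det (M := Matrix.of fun k j : Fin ℓ =>
    c j (Fin.castLE h.length_le_vars k)) hcoeff_zero

theorem exists_coeff_aeval_schurPoly_eq_det (h : WellSpaced lam n) :
    ∃ (z : Fin n → ℂ) (b : Fin n → MvPolynomial (Fin ℓ × Fin ℓ) ℂ),
      (∀ i, (b i).totalDegree ≤ 1) ∧
      (aeval (fun i => Polynomial.C (C (z i)) + Polynomial.X * Polynomial.C (b i))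
        (schurPoly lam n)).coeff ℓ = (Matrix.mvPolynomialX (Fin ℓ) (Fin ℓ) ℂ).det := by
  have hn : n ≠ 0 := (h.length_pos.trans_le h.length_le_vars).ne'
  obtain ⟨ζ, hζ⟩ : ∃ ζ : ℂ, IsPrimitiveRoot ζ n := ⟨_, Complex.isPrimitiveRoot_exp n hn⟩
  let z : Fin n → ℂ := fun i => ζ ^ (i : ℕ)
  have hz : Function.Injective z := fun i j hij => Fin.ext (hζ.pow_inj i.2 j.2 hij)
  have hroot (i : Fin n) : z i ^ n = 1 := by rw [pow_right_comm, hζ.pow_eq_one, one_pow]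
  obtain ⟨c, hc⟩ := exists_dual_of_pow hz
  let e : Fin ℓ × Fin ℓ → Fin n := fun p =>
    ⟨jacobiTrudiExponent lam p, Nat.lt_of_succ_lt (h.jacobiTrudiExponent_lt p)⟩
  have he : Function.Injective e := fun p q hpq =>
    h.jacobiTrudiExponent_injective (congrArg Fin.val hpq)
  refine ⟨z, fun i => ∑ p, C (c (e p) i) * X p, fun i => ?_, ?_⟩
  · exact totalDegree_finsetSum_le fun p _ => (totalDegree_mul _ _).trans (by simp)
  rw [h.coeff_aeval_schurPoly]
  · congr 1
    ext1 k j
    calc _ = ∑ i, C (z i ^ jacobiTrudiExponent lam (k, j)) * ∑ p, C (c (e p) i) * X p := by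
          simp
      _ = ∑ p, C (∑ i, c (e p) i * z i ^ (e (k, j) : ℕ)) * X p := by
          simp only [Finset.mul_sum, map_sum, Finset.sum_mul, map_mul]
          rw [Finset.sum_comm]
          exact Finset.sum_congr rfl fun p _ => Finset.sum_congr rfl fun i _ => by ring
      _ = X (k, j) := by simp [hc, he.eq_iff]
  · simpa [Function.comp_def] using (C_injective _ ℂ).comp hz
  · simp [← map_pow, hroot]

end WellSpaced

end JacobiTrudi

section FormulaExtraction

theorem natDegree_aeval_le_totalDegree {σ R A : Type*} [CommSemiring R] [CommSemiring A]
    [Algebra R A] {x : σ → Polynomial A} (hx : ∀ i, (x i).natDegree ≤ 1) (p : MvPolynomial σ R) :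
    (aeval x p).natDegree ≤ p.totalDegree := by
  rw [aeval_def, eval₂_eq]
  refine Polynomial.natDegree_sum_le_of_forall_le _ _ fun d hd => ?_
  rw [IsScalarTower.algebraMap_apply R A (Polynomial A), Polynomial.algebraMap_eq]
  calc _ ≤ (∏ i ∈ d.support, x i ^ d i).natDegree := Polynomial.natDegree_C_mul_le _ _
    _ ≤ ∑ i ∈ d.support, (x i ^ d i).natDegree := Polynomial.natDegree_prod_le _ _
    _ ≤ ∑ i ∈ d.support, d i := Finset.sum_le_sum fun i _ =>
      (Polynomial.natDegree_pow_le_of_le (d i) (hx i)).trans_eq (mul_one _)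
    _ ≤ p.totalDegree := le_totalDegree hd

theorem eval_aeval_polynomial {σ R A : Type*} [CommSemiring R] [CommSemiring A] [Algebra R A]
    (a : A) (x : σ → Polynomial A) (p : MvPolynomial σ R) :
    (aeval x p).eval a = aeval (fun i => (x i).eval a) p :=
  comp_aeval_apply x ((Polynomial.aeval (R := A) a).restrictScalars R) p

theorem hasFormula_coeff {σ : Type} {q : Polynomial (MvPolynomial σ ℂ)} {D s d l : ℕ}
    (hq : q.natDegree ≤ D) (hl : l ≤ D) (h : ∀ t : ℂ, HasFormula (q.eval (C t)) s d) :
    HasFormula (q.coeff l) (1 + (D + 1) * s) (d + 1) := by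
  have hinj : Function.Injective fun j : Fin (D + 1) => ((j : ℕ) : ℂ) :=
    Nat.cast_injective.comp Fin.val_injective
  obtain ⟨c, hc⟩ := exists_coeff_eq_sum_smul_eval (A := MvPolynomial σ ℂ) hinj
    ⟨l, Nat.lt_succ_of_le hl⟩
  simp only [hc q (Nat.lt_succ_of_le hq), smul_eq_C_mul, algebraMap_eq]
  simpa using HasFormula.sum c fun j : Fin (D + 1) => h (j : ℕ)

/-- A bound for the size of the determinant formula obtained from a formula of size `s` of a Schur
polynomial: `s + 1` interpolation points, at each of which the variables are replaced by affine
linear forms in at most `s ^ 2` variables. -/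
noncomputable def detFormulaSize : Polynomial ℕ :=
  1 + (Polynomial.X + 1) * (Polynomial.X * (Polynomial.X ^ 2 + 2))

theorem WellSpaced.hasFormula_det {ℓ n : ℕ} {lam : Fin ℓ → ℕ} (h : WellSpaced lam n) {s d : ℕ}
    (hF : HasFormula (schurPoly lam n) s d) :
    HasFormula (Matrix.mvPolynomialX (Fin ℓ) (Fin ℓ) ℂ).det (detFormulaSize.eval s) (d + 2) := by
  obtain ⟨z, b, hb, hdet⟩ := h.exists_coeff_aeval_schurPoly_eq_det
  set x : Fin n → Polynomial (MvPolynomial (Fin ℓ × Fin ℓ) ℂ) := fun i =>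
    Polynomial.C (C (z i)) + Polynomial.X * Polynomial.C (b i) with hx
  have hdegree : (aeval x (schurPoly lam n)).natDegree ≤ s := by
    refine (natDegree_aeval_le_totalDegree (fun i => ?_) _).trans hF.totalDegree_le
    simp only [hx]
    compute_degree
  have hlength : ℓ ≤ s := by
    refine (Polynomial.le_natDegree_of_ne_zero ?_).trans hdegree
    rw [hdet]
    exact Matrix.det_mvPolynomialX_ne_zero (Fin ℓ) ℂ
  have haffine (t : ℂ) (i : Fin n) : HasFormula ((x i).eval (C t)) (ℓ ^ 2 + 2) 1 := by
    have hdegree_eval : ((x i).eval (C t)).totalDegree ≤ 1 := by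
      simp only [hx, Polynomial.eval_add, Polynomial.eval_mul, Polynomial.eval_C, Polynomial.eval_X]
      refine (totalDegree_add _ _).trans (max_le (by simp) ((totalDegree_mul _ _).trans ?_))
      simpa using hb i
    simpa [pow_two] using hasFormula_of_totalDegree_le_one hdegree_eval
  have heval (t : ℂ) : HasFormula ((aeval x (schurPoly lam n)).eval (C t)) (s * (ℓ ^ 2 + 2))
      (d + 1) := by
    rw [eval_aeval_polynomial]
    exact hF.aeval (by omega) (haffine t)
  rw [← hdet]
  refine (hasFormula_coeff hdegree hlength heval).mono ?_ le_rfl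
  simp only [detFormulaSize, Polynomial.eval_add, Polynomial.eval_mul, Polynomial.eval_one,
    Polynomial.eval_X, Polynomial.eval_pow, Polynomial.eval_ofNat]
  gcongr

end FormulaExtraction

/-! ### Branching programs as determinants -/

section PathSums

theorem sum_mul_eq_sum_paths {A : Type*} [CommSemiring A] {n : ℕ} {V : Fin (n + 1) → Type*}
    [∀ i, Fintype (V i)] (label : ∀ i : Fin n, V i.castSucc → V i.succ → A) (v : ∀ i, V i → A)
    (hlast : ∀ u, v (Fin.last n) u = 1)
    (hstep : ∀ i u, v (Fin.castSucc i) u = ∑ u', label i u u' * v i.succ u') (c : V 0 → A) :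
    ∑ u, c u * v 0 u =
      ∑ path : (∀ i, V i), c (path 0) * ∏ i : Fin n, label i (path i.castSucc) (path i.succ) := by
  induction n with
  | zero =>
    rw [← (Fin.consEquiv V).sum_comp, Fintype.sum_prod_type]
    exact Finset.sum_congr rfl fun u _ => by simp [show v 0 u = 1 from hlast u, Fin.consEquiv]
  | succ n ih =>
    have htail := ih (V := fun i => V i.succ) (fun i => label i.succ) (fun i => v i.succ) hlast
      (fun i u => hstep i.succ u) fun u' => ∑ u, c u * label 0 u u'
    calc ∑ u, c u * v 0 u = ∑ u, ∑ u', c u * label 0 u u' * v (Fin.succ 0) u' :=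
          Finset.sum_congr rfl fun u _ => by
            rw [show v 0 u = _ from hstep 0 u, Finset.mul_sum]
            exact Finset.sum_congr rfl fun u' _ => (mul_assoc _ _ _).symm
      _ = ∑ u', (∑ u, c u * label 0 u u') * v (Fin.succ 0) u' := by
          rw [Finset.sum_comm]
          simp only [Finset.sum_mul]
      _ = _ := htail
      _ = ∑ path : (∀ i, V i),
          c (path 0) * ∏ i : Fin (n + 1), label i (path i.castSucc) (path i.succ) := by
        rw [← (Fin.consEquiv V).sum_comp, Fintype.sum_prod_type, Finset.sum_comm]
        refine Finset.sum_congr rfl fun path _ => ?_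
        rw [Finset.sum_mul]
        refine Finset.sum_congr rfl fun u _ => ?_
        rw [Fin.prod_univ_succ, ← mul_assoc]
        rfl

theorem det_one_sub_eq_one {ι α R : Type*} [Fintype ι] [DecidableEq ι] [LinearOrder α] [CommRing R]
    (b : ι → α) {N : Matrix ι ι R} (hN : ∀ i j, b j ≤ b i → N i j = 0) :
    (1 - N).det = 1 := by
  have htriangular : (1 - N).BlockTriangular b := fun i j hij => by
    simp [hN i j hij.le, Matrix.one_apply_ne fun h : i = j => hij.ne (h ▸ rfl)]
  rw [htriangular.det]
  refine Finset.prod_eq_one fun k _ => ?_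
  rw [← Matrix.det_one (n := {i // b i = k})]
  congr 1
  ext1 i j
  simp [Matrix.toSquareBlock_def, hN i j (j.2.trans i.2.symm).le, Matrix.one_apply,
    Subtype.ext_iff]

end PathSums

namespace ABP

variable {σ : Type} (B : ABP σ)

/-- The vertices of an ABP: pairs of a layer and a vertex of that layer. -/
abbrev Vertex : Type := Σ i : Fin (B.len + 1), Fin (B.width i)

theorem card_vertex : Fintype.card B.Vertex = B.size := by
  simp [size]

/-- The weighted adjacency matrix of an ABP, whose `(p, q)` entry is the label of the edge from `p`
to `q`. -/
noncomputable def adjacency : Matrix B.Vertex B.Vertex (MvPolynomial σ ℂ) :=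
  fun p => Fin.lastCases
    (motive := fun i => Fin (B.width i) → B.Vertex → MvPolynomial σ ℂ) (fun _ => 0)
    (fun i u => ∑ u', Pi.single ⟨i.succ, u'⟩ (B.label i u u')) p.1 p.2

theorem adjacency_last (u : Fin (B.width (Fin.last B.len))) : B.adjacency ⟨_, u⟩ = 0 := by
  simp [adjacency]

theorem adjacency_castSucc (i : Fin B.len) (u : Fin (B.width i.castSucc)) :
    B.adjacency ⟨_, u⟩ = ∑ u', Pi.single ⟨i.succ, u'⟩ (B.label i u u') := by
  simp [adjacency]

theorem totalDegree_adjacency_le (p q : B.Vertex) : (B.adjacency p q).totalDegree ≤ 1 := by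
  obtain ⟨i, u⟩ := p
  cases i using Fin.lastCases with
  | last => simp [adjacency_last]
  | cast i =>
    rw [adjacency_castSucc, Finset.sum_apply]
    refine totalDegree_finsetSum_le fun u' _ => ?_
    rw [Pi.single_apply]
    split_ifs
    · exact B.label_linear i u u'
    · simp

theorem adjacency_eq_zero (p q : B.Vertex) (h : q.1 ≤ p.1) : B.adjacency p q = 0 := by
  obtain ⟨i, u⟩ := p
  cases i using Fin.lastCases with
  | last => simp [adjacency_last]
  | cast i =>
    rw [adjacency_castSucc, Finset.sum_apply]
    refine Finset.sum_eq_zero fun u' _ => Pi.single_eq_of_ne ?_ _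
    rintro rfl
    exact h.not_gt Fin.castSucc_lt_succ

/-- The unique vertex of the first layer. -/
def source : B.Vertex := ⟨0, Fin.cast B.width_source.symm 0⟩

/-- The unique vertex of the last layer. -/
def sink : B.Vertex := ⟨Fin.last B.len, Fin.cast B.width_sink.symm 0⟩

theorem eq_sink (u : Fin (B.width (Fin.last B.len))) : (⟨_, u⟩ : B.Vertex) = B.sink := by
  have : Subsingleton (Fin (B.width (Fin.last B.len))) := by rw [B.width_sink]; infer_instance
  exact congrArg _ (Subsingleton.elim _ _)

theorem eval_eq_of_recursion (v : B.Vertex → MvPolynomial σ ℂ) (hsink : v B.sink = 1)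
    (hstep : ∀ i u, v ⟨Fin.castSucc i, u⟩ = ∑ u', B.label i u u' * v ⟨i.succ, u'⟩) :
    B.eval = v B.source := by
  have hpaths := sum_mul_eq_sum_paths (V := fun i => Fin (B.width i)) B.label
    (fun i u => v ⟨i, u⟩) (fun u => (congrArg v (B.eq_sink u)).trans hsink) hstep fun _ => 1
  simp only [one_mul] at hpaths
  have : Subsingleton (Fin (B.width 0)) := by rw [B.width_source]; infer_instance
  exact hpaths.symm.trans (Fintype.sum_subsingleton _ (Fin.cast B.width_source.symm 0))

/-- The matrix provided by Cramer's rule for the source coordinate of the solution of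
`(1 - adjacency) v = e_sink`. -/
noncomputable def detMatrix : Matrix B.Vertex B.Vertex (MvPolynomial σ ℂ) :=
  (1 - B.adjacency).updateCol B.source (Pi.single B.sink 1)

theorem totalDegree_detMatrix_le (p q : B.Vertex) : (B.detMatrix p q).totalDegree ≤ 1 := by
  rw [detMatrix, Matrix.updateCol_apply]
  split_ifs
  · rw [Pi.single_apply]
    split_ifs <;> simp
  · refine (totalDegree_sub _ _).trans (max_le ?_ (B.totalDegree_adjacency_le p q))
    rw [Matrix.one_apply]
    split_ifs <;> simp

theorem det_detMatrix : B.detMatrix.det = B.eval := by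
  set v := (1 - B.adjacency).cramer (Pi.single B.sink 1) with hv
  have hsolution : (1 - B.adjacency).mulVec v = Pi.single B.sink 1 := by
    rw [hv, Matrix.mulVec_cramer, det_one_sub_eq_one Sigma.fst B.adjacency_eq_zero, one_smul]
  rw [Matrix.sub_mulVec, Matrix.one_mulVec] at hsolution
  rw [B.eval_eq_of_recursion v]
  · exact (Matrix.cramer_apply _ _ _).symm
  · have h := congrFun hsolution B.sink
    rwa [Pi.sub_apply, Pi.single_eq_same, Matrix.mulVec, sink, adjacency_last, zero_dotProduct,
      sub_zero] at h
  · intro i u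
    have h := congrFun hsolution ⟨i.castSucc, u⟩
    rw [Pi.sub_apply, Pi.single_eq_of_ne, sub_eq_zero, Matrix.mulVec, adjacency_castSucc,
      sum_dotProduct] at h
    · simpa only [single_dotProduct] using h
    · exact fun h => (Fin.castSucc_lt_last i).ne (congrArg Sigma.fst h)

end ABP

theorem aeval_det_mvPolynomialX {R S m : Type*} [Fintype m] [DecidableEq m] [CommRing R]
    [CommRing S] [Algebra R S] (M : Matrix m m S) :
    aeval (fun p : m × m => M p.1 p.2) (Matrix.mvPolynomialX m m R).det = M.det := by
  rw [AlgHom.map_det, Matrix.mvPolynomialX_mapMatrix_aeval]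

theorem hasFormula_det_of_card_le {σ V : Type} [Fintype σ] [Fintype V] [DecidableEq V] {L s d : ℕ}
    (hF : HasFormula (Matrix.mvPolynomialX (Fin L) (Fin L) ℂ).det s d) (hL : Fintype.card V ≤ L)
    {M : Matrix V V (MvPolynomial σ ℂ)} (hM : ∀ p q, (M p q).totalDegree ≤ 1) :
    HasFormula M.det (s * (Fintype.card σ + 2)) (d + 1) := by
  let e : Fin L ≃ V ⊕ Fin (L - Fintype.card V) := Fintype.equivOfCardEq (by simp; omega)
  let N : Matrix (Fin L) (Fin L) (MvPolynomial σ ℂ) := (Matrix.fromBlocks M 0 0 1).submatrix e e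
  have hdet : N.det = M.det := by
    rw [Matrix.det_submatrix_equiv_self, Matrix.det_fromBlocks_zero₂₁, Matrix.det_one, mul_one]
  have hdegree (p q : Fin L) : (N p q).totalDegree ≤ 1 := by
    simp only [N, Matrix.submatrix_apply]
    rcases e p with a | a <;> rcases e q with b | b
    · exact hM a b
    · simp
    · simp
    · rw [Matrix.fromBlocks_apply₂₂, Matrix.one_apply]
      split_ifs <;> simp
  rw [← hdet, ← aeval_det_mvPolynomialX (R := ℂ)]
  exact hF.aeval (by omega) fun p => hasFormula_of_totalDegree_le_one (hdegree p.1 p.2)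

theorem ABP.hasFormula_eval {σ : Type} [Fintype σ] (B : ABP σ) {L s d : ℕ}
    (hF : HasFormula (Matrix.mvPolynomialX (Fin L) (Fin L) ℂ).det s d) (hL : B.size ≤ L) :
    HasFormula B.eval (s * (Fintype.card σ + 2)) (d + 1) := by
  rw [← B.det_detMatrix]
  exact hasFormula_det_of_card_le hF (B.card_vertex.trans_le hL) B.totalDegree_detMatrix_le

/-! ### Formulas as branching programs -/

/-- `v 0, …, v N` is a sequential program: it starts with `1`, and every later term is a combination
of earlier ones with coefficients of degree at most one. -/
structure IsAffineProgram {σ : Type} (v : ℕ → MvPolynomial σ ℂ) (N : ℕ) : Prop where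
  zero : v 0 = 1
  step : ∀ k < N, ∃ b : ℕ → MvPolynomial σ ℂ, (∀ j, (b j).totalDegree ≤ 1) ∧
    v (k + 1) = ∑ j ∈ Finset.range (k + 1), b j * v j

theorem IsAffineProgram.exists_insert {σ ι : Type} [Fintype ι] {v : ℕ → MvPolynomial σ ℂ} {N : ℕ}
    (hv : IsAffineProgram v N) {a h : ι → MvPolynomial σ ℂ} (ha : ∀ i, (a i).totalDegree ≤ 1)
    (hh : ∀ i, h i ∈ v '' Set.Iic N) :
    ∃ v', IsAffineProgram v' (N + 1) ∧
      v' '' Set.Iic (N + 1) = insert (∑ i, a i * h i) (v '' Set.Iic N) := by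
  choose k hk hvk using hh
  let v' := Function.update v (N + 1) (∑ i, a i * h i)
  have hagree : ∀ j ≤ N, v' j = v j := fun j hj => Function.update_of_ne (by omega) _ _
  have hlast : v' (N + 1) = ∑ i, a i * h i := Function.update_self _ _ _
  have hold : ∀ k ≤ N, ∀ b : ℕ → MvPolynomial σ ℂ,
      ∑ j ∈ Finset.range (k + 1), b j * v' j = ∑ j ∈ Finset.range (k + 1), b j * v j :=
    fun k hk b => Finset.sum_congr rfl fun j hj => by rw [hagree j (by grind)]
  refine ⟨v', ⟨(hagree 0 N.zero_le).trans hv.zero, fun n hn => ?_⟩, ?_⟩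
  · obtain rfl | hn := (Nat.lt_succ_iff.1 hn).eq_or_lt
    · refine ⟨fun j => ∑ i with k i = j, a i, fun j => totalDegree_finsetSum_le fun i _ => ha i, ?_⟩
      rw [hold n le_rfl, hlast, ← Finset.sum_fiberwise_of_maps_to (t := Finset.range (n + 1))
        fun i _ => Finset.mem_range_succ_iff.2 (hk i)]
      refine Finset.sum_congr rfl fun j _ => ?_
      rw [Finset.sum_mul]
      exact Finset.sum_congr rfl fun i hi => by rw [← hvk i, (Finset.mem_filter.1 hi).2]
    · obtain ⟨b, hb, hvb⟩ := hv.step n hn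
      exact ⟨b, hb, by rw [hold n hn.le, hagree (n + 1) hn, hvb]⟩
  · rw [← Order.succ_eq_add_one, Order.Iic_succ, Set.image_insert_eq, Order.succ_eq_add_one, hlast]
    exact congrArg _ (Set.image_congr hagree)

/-- Every program can be prolonged by at most `s` terms so as to contain the product of `p` with a
prescribed term. Carrying this factor along is what makes products of formulas sequential. -/
def Appendable {σ : Type} (p : MvPolynomial σ ℂ) (s : ℕ) : Prop :=
  ∀ ⦃v N⦄, IsAffineProgram v N → ∀ g ∈ v '' Set.Iic N, ∃ v' N', IsAffineProgram v' N' ∧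
    N' ≤ N + s ∧ v '' Set.Iic N ⊆ v' '' Set.Iic N' ∧ g * p ∈ v' '' Set.Iic N'

section Appendable

variable {σ ι : Type} {p q : MvPolynomial σ ℂ} {s t : ℕ} {f : ι → MvPolynomial σ ℂ} {r : ι → ℕ}

theorem appendable_of_totalDegree_le_one (hp : p.totalDegree ≤ 1) : Appendable p 1 := by
  intro v N hv g hg
  obtain ⟨v', hv', hterms⟩ := hv.exists_insert (ι := Unit) (fun _ => hp) fun _ => hg
  refine ⟨v', N + 1, hv', le_rfl, hterms ▸ Set.subset_insert _ _, ?_⟩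
  rw [hterms, Fintype.sum_unique, mul_comm]
  exact Set.mem_insert _ _

theorem appendable_one : Appendable (1 : MvPolynomial σ ℂ) 0 :=
  fun v N hv g hg => ⟨v, N, hv, le_rfl, subset_rfl, by rwa [mul_one]⟩

theorem Appendable.mono (hp : Appendable p s) (hst : s ≤ t) : Appendable p t := by
  intro v N hv g hg
  obtain ⟨v', N', hv', hN', hterms, hgp⟩ := hp hv g hg
  exact ⟨v', N', hv', by omega, hterms, hgp⟩

theorem Appendable.mul (hp : Appendable p s) (hq : Appendable q t) :
    Appendable (p * q) (s + t) := by
  intro v N hv g hg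
  obtain ⟨v₁, N₁, hv₁, hN₁, hterms₁, hgp⟩ := hp hv g hg
  obtain ⟨v₂, N₂, hv₂, hN₂, hterms₂, hgpq⟩ := hq hv₁ _ hgp
  exact ⟨v₂, N₂, hv₂, by omega, hterms₁.trans hterms₂, by rwa [← mul_assoc]⟩

theorem Appendable.prod (S : Finset ι) (hf : ∀ i, Appendable (f i) (r i)) :
    Appendable (∏ i ∈ S, f i) (∑ i ∈ S, r i) := by
  classical
  induction S using Finset.induction_on with
  | empty => simpa using appendable_one
  | insert i S hi ih =>
    rw [Finset.prod_insert hi, Finset.sum_insert hi]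
    exact (hf i).mul ih

theorem IsAffineProgram.exists_forall_mul_mem {v : ℕ → MvPolynomial σ ℂ} {N : ℕ}
    (hv : IsAffineProgram v N) {g : MvPolynomial σ ℂ} (hg : g ∈ v '' Set.Iic N) (S : Finset ι)
    (hf : ∀ i, Appendable (f i) (r i)) :
    ∃ v' N', IsAffineProgram v' N' ∧ N' ≤ N + ∑ i ∈ S, r i ∧
      v '' Set.Iic N ⊆ v' '' Set.Iic N' ∧ ∀ i ∈ S, g * f i ∈ v' '' Set.Iic N' := by
  classical
  induction S using Finset.induction_on with
  | empty => exact ⟨v, N, hv, le_rfl, subset_rfl, by simp⟩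
  | insert i S hi ih =>
    obtain ⟨v₁, N₁, hv₁, hN₁, hterms₁, hS⟩ := ih
    obtain ⟨v₂, N₂, hv₂, hN₂, hterms₂, hgi⟩ := hf i hv₁ g (hterms₁ hg)
    refine ⟨v₂, N₂, hv₂, ?_, hterms₁.trans hterms₂,
      Finset.forall_mem_insert _ _ _ |>.2 ⟨hgi, fun j hj => hterms₂ (hS j hj)⟩⟩
    rw [Finset.sum_insert hi]
    omega

theorem Appendable.sum [Fintype ι] (c : ι → ℂ) (hf : ∀ i, Appendable (f i) (r i)) :
    Appendable (∑ i, C (c i) * f i) (1 + ∑ i, r i) := by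
  intro v N hv g hg
  obtain ⟨v₁, N₁, hv₁, hN₁, hterms₁, hgf⟩ := hv.exists_forall_mul_mem hg Finset.univ hf
  obtain ⟨v₂, hv₂, hterms₂⟩ := hv₁.exists_insert (a := fun i => C (c i)) (by simp)
    fun i => hgf i (Finset.mem_univ i)
  refine ⟨v₂, N₁ + 1, hv₂, by omega, hterms₂ ▸ hterms₁.trans (Set.subset_insert _ _), ?_⟩
  rw [hterms₂, Finset.mul_sum]
  exact Or.inl (Finset.sum_congr rfl fun i _ => mul_left_comm _ _ _)

theorem AlgFormula.appendable_eval (F : AlgFormula σ) : Appendable F.eval F.size := by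
  induction F with
  | const c => exact appendable_of_totalDegree_le_one (by simp [eval])
  | var i => exact appendable_of_totalDegree_le_one (by simp [eval])
  | sum m c f ih => exact Appendable.sum c ih
  | prod m f ih => exact (Appendable.prod Finset.univ ih).mono (Nat.le_add_left _ 1)

theorem AlgFormula.exists_isAffineProgram (F : AlgFormula σ) :
    ∃ v N, IsAffineProgram v N ∧ N ≤ F.size ∧ v N = F.eval := by
  obtain ⟨v, N, hv, hN, -, k, hk, hvk⟩ :=
    F.appendable_eval (v := fun _ => 1) (N := 0) ⟨rfl, by simp⟩ 1 ⟨0, Set.self_mem_Iic, rfl⟩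
  rw [Set.mem_Iic] at hk
  exact ⟨v, k, ⟨hv.zero, fun j hj => hv.step j (by omega)⟩, by omega, hvk.trans (one_mul _)⟩

end Appendable

namespace ABP

variable {σ : Type} {N : ℕ} {b : Fin N → ℕ → MvPolynomial σ ℂ}

/-- The label of the edge from the term of index `k` in layer `i` to the term of index `j` in the
next layer of the ABP `unroll`: the term of index `N - i` is expanded, the others are passed on. -/
noncomputable def unrollLabel (b : Fin N → ℕ → MvPolynomial σ ℂ) (i : Fin N) (k j : ℕ) :
    MvPolynomial σ ℂ :=
  if k + i = N then b i j else if k = j then 1 else 0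

theorem totalDegree_unrollLabel_le (hb : ∀ i j, (b i j).totalDegree ≤ 1) (i : Fin N) (k j : ℕ) :
    (unrollLabel b i k j).totalDegree ≤ 1 := by
  unfold unrollLabel
  split_ifs <;> simp [hb]

theorem sum_unrollLabel_mul {v : ℕ → MvPolynomial σ ℂ}
    (hv : ∀ i : Fin N, v (N - i) = ∑ j ∈ Finset.range (N - i), b i j * v j) {i : Fin N} {k : ℕ}
    (hk : k + i ≤ N) : ∑ j ∈ Finset.range (N - i), unrollLabel b i k j * v j = v k := by
  unfold unrollLabel
  split_ifs with hki
  · rw [← hv i, show N - i = k by omega]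
  · simp [show k < N - i by omega]

/-- The ABP unrolling a program `v 0, …, v N` in which `v (N - i)` is the combination of the earlier
terms with coefficients `b i`. The vertices of layer `i` stand for `v 0, …, v (N - i)`, except that
the first layer has a vertex for `v N` only. -/
noncomputable def unroll (b : Fin N → ℕ → MvPolynomial σ ℂ)
    (hb : ∀ i j, (b i j).totalDegree ≤ 1) : ABP σ where
  len := N
  width i := if (i : ℕ) = 0 then 1 else N + 1 - i
  width_source := by simp
  width_sink := by simp +contextual
  label i u j := unrollLabel b i (if (i : ℕ) = 0 then N else u) j
  label_linear i _ _ := totalDegree_unrollLabel_le hb i _ _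

theorem size_unroll_le (hb : ∀ i j, (b i j).totalDegree ≤ 1) :
    (unroll b hb).size ≤ (N + 1) ^ 2 := by
  have hwidth (i) : (unroll b hb).width i ≤ N + 1 := by
    simp only [unroll]
    split_ifs <;> omega
  calc (unroll b hb).size ≤ ∑ _ : Fin (N + 1), (N + 1) := Finset.sum_le_sum fun i _ => hwidth i
    _ = (N + 1) ^ 2 := by simp [sq]

theorem eval_unroll (hb : ∀ i j, (b i j).totalDegree ≤ 1) {v : ℕ → MvPolynomial σ ℂ}
    (hzero : v 0 = 1) (hv : ∀ i : Fin N, v (N - i) = ∑ j ∈ Finset.range (N - i), b i j * v j) :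
    (unroll b hb).eval = v N := by
  rw [eval_eq_of_recursion _ fun p => v (if (p.1 : ℕ) = 0 then N else p.2)]
  · simp [source]
  · rw [← hzero]
    congr 1
    split_ifs with h
    · exact h
    · simp [sink]
  · intro i u
    have hu : (if (i : ℕ) = 0 then N else u : ℕ) + i ≤ N := by
      have hwidth : (u : ℕ) < if (i : ℕ) = 0 then 1 else N + 1 - i := u.2
      split_ifs at hwidth ⊢ <;> omega
    have hwidth : (unroll b hb).width i.succ = N - i := by
      change (if (i : ℕ) + 1 = 0 then 1 else N + 1 - (i + 1)) = N - i
      simp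
    refine (sum_unrollLabel_mul hv hu).symm.trans ?_
    rw [← hwidth, ← Fin.sum_univ_eq_sum_range]
    rfl

end ABP

theorem IsAffineProgram.exists_abp {σ : Type} {v : ℕ → MvPolynomial σ ℂ} {N : ℕ}
    (hv : IsAffineProgram v N) : ∃ B : ABP σ, B.eval = v N ∧ B.size ≤ (N + 1) ^ 2 := by
  have hstep (i : Fin N) : ∃ b : ℕ → MvPolynomial σ ℂ, (∀ j, (b j).totalDegree ≤ 1) ∧
      v (N - i) = ∑ j ∈ Finset.range (N - i), b j * v j := by
    have := hv.step (N - i - 1) (by omega)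
    rwa [Nat.sub_add_cancel (by omega)] at this
  choose b hb hvb using hstep
  exact ⟨ABP.unroll b hb, ABP.eval_unroll hb hv.zero hvb, ABP.size_unroll_le hb⟩

theorem VF_subset_VBP : VF ⊆ VBP := by
  rintro f ⟨hvars, s, ⟨p, hp⟩, hs⟩
  refine ⟨hvars, fun k => (s k + 1) ^ 2, ⟨(p + 1) ^ 2, fun k => ?_⟩, fun k => ?_⟩
  · rw [Polynomial.eval_pow, Polynomial.eval_add, Polynomial.eval_one]
    exact Nat.pow_le_pow_left (Nat.succ_le_succ (hp k)) 2
  · obtain ⟨F, hF, hFs⟩ := hs k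
    obtain ⟨v, N, hv, hN, hvF⟩ := F.exists_isAffineProgram
    obtain ⟨B, hB, hBs⟩ := hv.exists_abp
    exact ⟨B, hB.trans (hvF.trans hF), hBs.trans (Nat.pow_le_pow_left (by omega) 2)⟩

/-! ### The classes `VF` and `VBP` -/

theorem monotone_eval_of_natPolynomial (p : Polynomial ℕ) : Monotone fun k => p.eval k := by
  intro a b hab
  simp only [Polynomial.eval_eq_sum_range]
  gcongr

theorem exists_le_of_le_eval {ℓ : ℕ → ℕ} {p : Polynomial ℕ} (hp : ∀ k, k ≤ p.eval (ℓ k)) (N : ℕ) :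
    N ≤ ℓ (p.eval N + 1) := by
  by_contra! hlt
  exact (hp _).not_gt (Nat.lt_succ_iff.2 (monotone_eval_of_natPolynomial p hlt.le))

theorem VBP_subset_VF_of_schurFamily {ℓ : ℕ → ℕ} {lam : ∀ k, Fin (ℓ k) → ℕ} {n : ℕ → ℕ}
    (hlam : ∀ k, WellSpaced (lam k) (n k)) (hℓ : ∃ p : Polynomial ℕ, ∀ k, k ≤ p.eval (ℓ k))
    (h : (schurFamily lam n).HasPolySizeFormulas) : VBP ⊆ VF := by
  obtain ⟨p, hp⟩ := hℓ
  obtain ⟨s, ⟨r, hr⟩, hs⟩ := h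
  rintro f ⟨⟨v, hv⟩, t, ⟨q, hq⟩, ht⟩
  let index (k : ℕ) : ℕ := p.eval (q.eval k) + 1
  refine ⟨⟨v, hv⟩, fun k => detFormulaSize.eval (r.eval (index k)) * (v.eval k + 2),
    ⟨detFormulaSize.comp (r.comp (p.comp q + 1)) * (v + 2), fun k => by simp [index]⟩, fun k => ?_⟩
  obtain ⟨B, hB, hBs⟩ := ht k
  obtain ⟨F, hF, hFs⟩ := hs (index k)
  have hschur : HasFormula (schurPoly (lam (index k)) (n (index k))) (r.eval (index k)) F.depth :=
    ⟨F, hF, hFs.trans (hr _), le_rfl⟩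
  have hsize : B.size ≤ ℓ (index k) := hBs.trans ((hq k).trans (exists_le_of_le_eval hp _))
  obtain ⟨G, hG, hGs, -⟩ := B.hasFormula_eval ((hlam _).hasFormula_det hschur) hsize
  refine ⟨G, hG.trans hB, hGs.trans (Nat.mul_le_mul_left _ ?_)⟩
  rw [Fintype.card_fin]
  exact Nat.add_le_add_right (hv k) 2

theorem exists_wellSpaced_polyBounded : ∃ (ℓ : ℕ → ℕ) (lam : ∀ k, Fin (ℓ k) → ℕ) (n : ℕ → ℕ),
    (∀ k, WellSpaced (lam k) (n k)) ∧
    (∃ p : Polynomial ℕ, ∀ k, k ≤ p.eval (ℓ k)) ∧ PolyBounded n := by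
  refine ⟨fun k => k + 1, fun k i => k + 1 + (k - i) * k, fun k => k + 1 + k * k + (k + 1),
    fun k => ⟨k.succ_pos, fun i j hij => ?_, by simp, fun i hi => by simp [hi]⟩,
    ⟨Polynomial.X, by simp⟩,
    ⟨Polynomial.X + 1 + Polynomial.X * Polynomial.X + (Polynomial.X + 1), by simp⟩⟩
  have hsub : k - (i : ℕ) = k - j + 1 := by have : (j : ℕ) < k + 1 := j.2; omega
  change k + 1 + (k - (j : ℕ)) * k + (k + 1 - 1) ≤ k + 1 + (k - (i : ℕ)) * k
  rw [hsub, Nat.add_sub_cancel, Nat.succ_mul, add_assoc]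

/-- Formula complexity of Schur polynomials against that of the symbolic determinant.
* The polynomial `P` and the constant `c` are absolute.
* In the second part, the lengths `ℓ k` are polynomially related to the index `k`.
* The third part says that such sequences exist with polynomially many variables. -/
theorem theorem1p1 :
    (∃ (P : Polynomial ℕ) (c : ℕ), ∀ (ℓ : ℕ) (lam : Fin ℓ → ℕ) (n : ℕ), WellSpaced lam n →
      ∀ s Δ : ℕ, HasFormula (schurPoly lam n) s Δ →
        HasFormula (Matrix.mvPolynomialX (Fin ℓ) (Fin ℓ) ℂ).det (P.eval s) (Δ + c)) ∧
    (∀ (ℓ : ℕ → ℕ) (lam : ∀ k, Fin (ℓ k) → ℕ) (n : ℕ → ℕ),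
      (∀ k, WellSpaced (lam k) (n k)) →
      (∃ p : Polynomial ℕ, ∀ k, k ≤ p.eval (ℓ k)) →
      VBP ≠ VF → ¬ (schurFamily lam n).HasPolySizeFormulas) ∧
    (∃ (ℓ : ℕ → ℕ) (lam : ∀ k, Fin (ℓ k) → ℕ) (n : ℕ → ℕ),
      (∀ k, WellSpaced (lam k) (n k)) ∧
      (∃ p : Polynomial ℕ, ∀ k, k ≤ p.eval (ℓ k)) ∧ PolyBounded n) :=
  ⟨⟨detFormulaSize, 2, fun _ _ _ h _ _ hF => h.hasFormula_det hF⟩,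
    fun _ _ _ hlam hℓ hne h =>
      hne (Set.Subset.antisymm (VBP_subset_VF_of_schurFamily hlam hℓ h) VF_subset_VBP),
    exists_wellSpaced_polyBounded⟩
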